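/- **Theorem (expansions of the random field Ising model).** Let $G$ be a finite graph (loops and multiple edges allowed) whose edges are linearly ordered, with a weight $z_i\in\mathbb{C}$ at each vertex $i$, and let $J,\beta\in\mathbb{C}$. For any vertex-weighted graph $H$ put $$h(\tau)=-J\sum_{\{i,j\}\in E(H)}\tau_i\tau_j-\sum_{i\in V(H)}z_i\tau_i,\qquad Z(H)=\sum_{\tau:V(H)\to\{-1,1\}}e^{-\beta h(\tau)},\qquad \eta(H)=J|E(H)|+3\sum_{i\in V(H)}z_i .$$ Terminology. Spanning subgraphs are identified with their edge sets. A spanning forest of $G$ is an acyclic spanning subgraph; $\mathcal F(G)$ is the set of spanning forests. A spanning tree of $G$ is a spanning forest whose restriction to each connected component of $G$ is connected; $\mathcal T(G)$ is the set of spanning trees. For $F\in\mathcal F(G)$, the set $\mathcal{E_A}(G,F)$ of externally active edges consists of the edges $e\in E(G)\setminus F$ such that $F\cup\{e\}$ contains a cycle (necessarily unique) and $e$ is the smallest edge of it. For $T\in\mathcal T(G)$, the set $\mathcal{I_I}(G,T)$ of internally inactive edges consists of the edges $e\in T$ that are not the smallest element of the cut $\{f\in E(G): (T\setminus\{e\})\cup\{f\}\in\mathcal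 T(G)\}$. In $T/\mathcal{I_I}(G,T)$, the graph obtained from the spanning subgraph $T$ by contracting the edges of $\mathcal{I_I}(G,T)$, the weight of a vertex is the sum of the weights of the vertices of $G$ that were merged into it. 1. With $x_c=e^{2\beta c}+e^{4\beta c}$ for $c\in\mathbb{C}$, and $x(F)=x_{c_1}\cdots x_{c_k}$, where $c_j$ is the sum of the vertex weights in the $j$-th connected component of the spanning subgraph $F$ (isolated vertices count as components), $$Z(G)=e^{-\beta\eta(G)}\sum_{F\in\mathcal F(G)}x(F)\,\bigl(e^{2\beta J}-1\bigr)^{|E(F)|}\prod_{e\in\mathcal{E_A}(G,F)}e^{2\beta J}.$$ 2. $$Z(G)=e^{-\beta\eta(G)}\sum_{T\in\mathcal T(G)}\bigl(e^{2\beta J}-1\bigr)^{|\mathcal{I_I}(G,T)|}\;e^{\,2\beta J|\mathcal{E_A}(G,T)|+\beta\,\eta(T/\mathcal{I_I}(G,T))}\;Z\bigl(T/\mathcal{I_I}(G,T)\bigr).$$ -/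

import Mathlib

namespace Graph

variable {α ε : Type*}

/-! ### Connectivity and cycles in multigraphs -/

/-- The set of vertices that can be reached from `x` by a walk in `G`; for a vertex `x` of `G` this
is the vertex set of the connected component of `G` that contains `x`. -/
def componentOf (G : Graph α ε) (x : α) : Set α :=
  {y | Relation.ReflTransGen G.Adj x y}

/-- The (vertex sets of the) connected components of `G`. -/
def components (G : Graph α ε) : Set (Set α) :=
  G.componentOf '' V(G)

/-- `G` has exactly one connected component. -/
def IsConnected (G : Graph α ε) : Prop :=
  V(G).Nonempty ∧ ∀ x ∈ V(G), ∀ y ∈ V(G), y ∈ G.componentOf x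

/-- `C` is the edge set of a cycle of `G`: there are distinct vertices `v 0, …, v n` and distinct
edges `e 0, …, e n` such that `e i` joins `v i` to `v (i + 1)`, with indices modulo `n + 1`.
A loop is a cycle of length one, and two parallel edges form a cycle of length two. -/
def IsCycleSet (G : Graph α ε) (C : Set ε) : Prop :=
  ∃ (n : ℕ) (v : Fin (n + 1) → α) (e : Fin (n + 1) → ε),
    Function.Injective v ∧ Function.Injective e ∧
      (∀ i, G.IsLink (e i) (v i) (v (i + 1))) ∧ C = Set.range e

/-! ### Spanning forests, spanning trees and activities

A spanning subgraph `(V(G), A)` of `G` is given by its edge set `A ⊆ E(G)`; as a graph it is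
`G.restrict A`. -/

/-- `F` is the edge set of a spanning forest (an acyclic spanning subgraph) of `G`. -/
def IsSpanningForest (G : Graph α ε) (F : Set ε) : Prop :=
  F ⊆ E(G) ∧ ∀ C, ¬ (G.restrict F).IsCycleSet C

/-- `T` is the edge set of a spanning tree of `G`, in the sense that is used for graphs which need
not be connected: `T` is acyclic, and restricts to a connected spanning subgraph of each connected
component of `G`. -/
def IsSpanningTree (G : Graph α ε) (T : Set ε) : Prop :=
  G.IsSpanningForest T ∧ ∀ C ∈ G.components, ((G.restrict T).induce C).IsConnected

/-- The cut defined by the edge `e` of the spanning tree `T`. -/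
def cut (G : Graph α ε) (T : Set ε) (e : ε) : Set ε :=
  {f ∈ E(G) | G.IsSpanningTree (insert f (T \ {e}))}

/-- The internally inactive edges of `G` with respect to the spanning tree `T`: the edges of `T`
that are not the smallest edge of the cut which they define. -/
def internallyInactive [LinearOrder ε] (G : Graph α ε) (T : Set ε) : Set ε :=
  {e ∈ T | ¬ IsLeast (G.cut T e) e}

/-- The externally active edges of `G` with respect to the spanning forest `F` (in particular, with
respect to a spanning tree): the edges `e ∉ F` such that `F ∪ {e}` contains a cycle in which `e` is
the smallest edge. As `F` is acyclic, there is at most one cycle in `F ∪ {e}`; an edge that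
closes no cycle with `F` is not externally active. -/
def externallyActive [LinearOrder ε] (G : Graph α ε) (F : Set ε) : Set ε :=
  {e ∈ E(G) \ F | ∃ C, (G.restrict (insert e F)).IsCycleSet C ∧ IsLeast C e}

/-! ### Contraction of vertex-weighted graphs -/

/-- The graph `G / A` obtained by contracting the edges in `A`. Its vertices are the connected
components of the spanning subgraph `(V(G), A)`, and its edges are those of `G` outside `A`. -/
def contract (G : Graph α ε) (A : Set ε) : Graph (Set α) ε :=
  (G.deleteEdges A).map (G.restrict A).componentOf

/-- The total weight of a set of vertices. As a function of `C`, these are also the vertex weights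
of a contraction, where the weight of a new vertex is the sum of the weights of the vertices that
were merged into it. -/
noncomputable def weight (z : α → ℂ) (C : Set α) : ℂ :=
  ∑ᶠ v ∈ C, z v

/-! ### The random field Ising model -/

theorem exists_ends (G : Graph α ε) (e : E(G)) :
    ∃ p : Sym2 V(G), ∀ x y : V(G), p = s(x, y) ↔ G.IsLink e x y := by
  obtain ⟨x, y, h⟩ := G.exists_isLink_of_mem_edgeSet e.2
  refine ⟨s(⟨x, h.left_mem⟩, ⟨y, h.right_mem⟩), fun x' y' => ?_⟩
  rw [h.isLink_iff, Sym2.eq_iff]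
  simp only [Subtype.ext_iff]

/-- The unordered pair of ends of an edge. -/
noncomputable def ends (G : Graph α ε) (e : E(G)) : Sym2 V(G) :=
  (G.exists_ends e).choose

theorem ends_eq_iff (G : Graph α ε) (e : E(G)) (x y : V(G)) :
    G.ends e = s(x, y) ↔ G.IsLink e x y :=
  (G.exists_ends e).choose_spec x y

/-- The Hamiltonian `h(τ) = -J ∑_{e = {i, j}} τ_i τ_j - ∑_i z_i τ_i` of the random field Ising model,
for a state `τ : V(G) → {-1, 1}`. -/
noncomputable def rfimHamiltonian (G : Graph α ε) (z : α → ℂ) (J : ℂ) (τ : V(G) → ℤˣ) : ℂ :=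
  -J * ∑ᶠ e : E(G), ((((G.ends e).map τ).mul : ℤ) : ℂ) - ∑ᶠ v : V(G), z v * ((τ v : ℤ) : ℂ)

/-- The partition function `Z(G)` of the random field Ising model. -/
noncomputable def rfimZ (G : Graph α ε) (z : α → ℂ) (J β : ℂ) : ℂ :=
  ∑ᶠ τ : V(G) → ℤˣ, Complex.exp (-β * G.rfimHamiltonian z J τ)

/-- `η(G) = J |E(G)| + 3 ∑_i z_i`. -/
noncomputable def rfimEta (G : Graph α ε) (z : α → ℂ) (J : ℂ) : ℂ :=
  J * (E(G).ncard : ℂ) + 3 * weight z V(G)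

/-- `x_c = exp (2βc) + exp (4βc)`. -/
noncomputable def rfimX (β c : ℂ) : ℂ :=
  Complex.exp (2 * β * c) + Complex.exp (4 * β * c)

/-- `x(F)`, the product of `x_c` over the components of the spanning forest `F`, where `c` is the
total vertex weight of the component. -/
noncomputable def rfimForestX (G : Graph α ε) (z : α → ℂ) (β : ℂ) (F : Set ε) : ℂ :=
  ∏ᶠ C ∈ (G.restrict F).components, rfimX β (weight z C)

end Graph

namespace Graph

variable {α ε : Type*} {G : Graph α ε}

/-! ### Reachability in spanning subgraphs -/

/-! Both expansions come from one sum over all edge sets. Put `y = exp (2βJ) - 1`. For a spin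
product `s = ±1`, `exp (βJs) = exp (-βJ) * (1 + y * [s = 1])`; expanding over the edges leaves, for
each edge set `A`, the states constant on the components of `(V, A)`. Writing each vertex factor as
`exp (-3βz)` times `exp (βz(τ + 3))`, their sum is `x(A)`. This is `rfimZ_eq_finsum_powerset`: `Z`
is `exp (-βη)` times the sum of `x(A) y^|A|`.

The edge sets are then partitioned into the intervals `[F, F ∪ EA(F)]` over spanning forests, or
`[II(T), T ∪ EA(T)]` over spanning trees (`existsUnique_isSpanningForest`,
`existsUnique_isSpanningTree`). Each set determines its forest or tree by a greedy construction, and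
cycles and cuts are handled throughout by the cycle-matroid closure `edgeSpan`.

Externally active edges do not change components, so summing over them gives `(y + 1)^|EA| = exp
(2βJ|EA|)`. This finishes the forest case. For a tree, `EA(T)` is already spanned by `II(T)`; what
remains is a sum over subsets of `T \ II(T)`, which is the same subgraph expansion of `T / II(T)`
and is folded back into its partition function. -/

theorem restrict_adj_iff {A : Set ε} {x y : α} :
    (G.restrict A).Adj x y ↔ ∃ e ∈ A, G.IsLink e x y := Iff.rfl

theorem mem_componentOf_self (x : α) : x ∈ G.componentOf x := Relation.ReflTransGen.refl

theorem mem_componentOf_symm {x y : α} (h : y ∈ G.componentOf x) : x ∈ G.componentOf y :=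
  have : Std.Symm G.Adj := ⟨fun _ _ h => h.symm⟩
  Relation.ReflTransGen.stdSymm.symm _ _ h

theorem mem_componentOf_trans {x y w : α} (h : y ∈ G.componentOf x) (h' : w ∈ G.componentOf y) :
    w ∈ G.componentOf x :=
  Relation.ReflTransGen.trans h h'

theorem mem_componentOf_of_adj {x y : α} (h : G.Adj x y) : y ∈ G.componentOf x :=
  Relation.ReflTransGen.single h

theorem componentOf_eq_iff {x y : α} : G.componentOf x = G.componentOf y ↔ y ∈ G.componentOf x := by
  refine ⟨fun h => h ▸ mem_componentOf_self y, fun h => Set.ext fun w => ⟨fun hw => ?_, fun hw => ?_⟩⟩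
  · exact mem_componentOf_trans (mem_componentOf_symm h) hw
  · exact mem_componentOf_trans h hw

theorem componentOf_subset_vertexSet {x : α} (hx : x ∈ V(G)) : G.componentOf x ⊆ V(G) := by
  intro y hy
  induction hy with
  | refl => exact hx
  | tail _ h _ => exact h.right_mem

theorem componentOf_mono {H : Graph α ε} (h : ∀ x y, H.Adj x y → y ∈ G.componentOf x) (x : α) :
    H.componentOf x ⊆ G.componentOf x := by
  intro y hy
  induction hy with
  | refl => exact mem_componentOf_self x
  | tail _ h' ih => exact mem_componentOf_trans ih (h _ _ h')

theorem componentOf_restrict_mono {A B : Set ε} (h : A ⊆ B) (x : α) :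
    (G.restrict A).componentOf x ⊆ (G.restrict B).componentOf x :=
  componentOf_mono (fun _ _ hadj => mem_componentOf_of_adj <|
    let ⟨e, he, hl⟩ := restrict_adj_iff.1 hadj; ⟨e, h he, hl⟩) x

/-! ### The edges spanned by a set of edges -/

/-- The edges of `G` whose ends are connected by edges in `A`: the closure of `A` in the cycle
matroid of `G`. -/
def edgeSpan (G : Graph α ε) (A : Set ε) : Set ε :=
  {e | ∃ x y, G.IsLink e x y ∧ y ∈ (G.restrict A).componentOf x}

theorem edgeSpan_subset (A : Set ε) : G.edgeSpan A ⊆ E(G) :=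
  fun _ ⟨_, _, h, _⟩ => h.edge_mem

theorem IsLink.mem_edgeSpan_iff {A : Set ε} {e : ε} {x y : α} (h : G.IsLink e x y) :
    e ∈ G.edgeSpan A ↔ y ∈ (G.restrict A).componentOf x := by
  refine ⟨fun ⟨x', y', h', hc⟩ => ?_, fun hc => ⟨x, y, h, hc⟩⟩
  obtain ⟨rfl, rfl⟩ | ⟨rfl, rfl⟩ := h.eq_and_eq_or_eq_and_eq h'
  · exact hc
  · exact mem_componentOf_symm hc

theorem edgeSpan_mono {A B : Set ε} (h : A ⊆ B) : G.edgeSpan A ⊆ G.edgeSpan B :=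
  fun _ ⟨x, y, hl, hc⟩ => ⟨x, y, hl, componentOf_restrict_mono h x hc⟩

theorem mem_edgeSpan_of_subset {A B : Set ε} {e : ε} (h : A ⊆ B) (he : e ∈ G.edgeSpan A) :
    e ∈ G.edgeSpan B :=
  edgeSpan_mono h he

theorem mem_edgeSpan {A : Set ε} {e : ε} (he : e ∈ E(G)) (h : e ∈ A) : e ∈ G.edgeSpan A := by
  obtain ⟨x, y, hl⟩ := G.exists_isLink_of_mem_edgeSet he
  exact ⟨x, y, hl, mem_componentOf_of_adj ⟨e, h, hl⟩⟩

theorem subset_edgeSpan {A : Set ε} (hA : A ⊆ E(G)) : A ⊆ G.edgeSpan A :=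
  fun _ he => mem_edgeSpan (hA he) he

theorem componentOf_restrict_subset_of_subset_edgeSpan {A B : Set ε} (h : A ⊆ G.edgeSpan B)
    (x : α) : (G.restrict A).componentOf x ⊆ (G.restrict B).componentOf x :=
  componentOf_mono (fun _ _ hadj =>
    let ⟨_, he, hl⟩ := restrict_adj_iff.1 hadj; hl.mem_edgeSpan_iff.1 (h he)) x

theorem edgeSpan_subset_of_subset {A B : Set ε} (h : A ⊆ G.edgeSpan B) :
    G.edgeSpan A ⊆ G.edgeSpan B :=
  fun _ ⟨x, y, hl, hc⟩ => ⟨x, y, hl, componentOf_restrict_subset_of_subset_edgeSpan h x hc⟩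

/-- Each edge of `B` can be replaced by a walk in `A`. This makes `x` constant when spanned edges
are added, so interval sums factor. -/
theorem components_restrict_eq_of_subset_edgeSpan {A B : Set ε} (hAB : A ⊆ B)
    (h : B ⊆ G.edgeSpan A) : (G.restrict B).components = (G.restrict A).components := by
  have : (G.restrict B).componentOf = (G.restrict A).componentOf := funext fun x =>
    (componentOf_restrict_subset_of_subset_edgeSpan h x).antisymm (componentOf_restrict_mono hAB x)
  rw [components, components, this]
  rfl

/-! ### Cycles -/

theorem isCycleSet_restrict_iff {A C : Set ε} :
    (G.restrict A).IsCycleSet C ↔ G.IsCycleSet C ∧ C ⊆ A := by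
  constructor
  · rintro ⟨n, v, e, hv, he, hl, rfl⟩
    exact ⟨⟨n, v, e, hv, he, fun i => (hl i).2, rfl⟩, by rintro _ ⟨i, rfl⟩; exact (hl i).1⟩
  · rintro ⟨⟨n, v, e, hv, he, hl, rfl⟩, hA⟩
    exact ⟨n, v, e, hv, he, fun i => ⟨hA ⟨i, rfl⟩, hl i⟩, rfl⟩

theorem IsCycleSet.subset_edgeSet {C : Set ε} (h : G.IsCycleSet C) : C ⊆ E(G) := by
  obtain ⟨n, v, e, -, -, hl, rfl⟩ := h
  rintro _ ⟨i, rfl⟩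
  exact (hl i).edge_mem

theorem IsCycleSet.finite {C : Set ε} (h : G.IsCycleSet C) : C.Finite := by
  obtain ⟨n, v, e, -, -, -, rfl⟩ := h
  exact Set.finite_range e

theorem IsCycleSet.nonempty {C : Set ε} (h : G.IsCycleSet C) : C.Nonempty := by
  obtain ⟨n, v, e, -, -, -, rfl⟩ := h
  exact Set.range_nonempty e

-- Going around the cycle the other way joins the ends of `e` without using `e`.
open Fin.NatCast in
theorem IsCycleSet.mem_edgeSpan {C : Set ε} (h : G.IsCycleSet C) {e : ε} (he : e ∈ C) :
    e ∈ G.edgeSpan (C \ {e}) := by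
  obtain ⟨n, v, e, -, hinj, hl, rfl⟩ := h
  obtain ⟨i, rfl⟩ := he
  refine (hl i).symm.mem_edgeSpan_iff.2 ?_
  have key : ∀ k : ℕ, k ≤ n → v (i + 1 + (k : Fin (n + 1))) ∈
      (G.restrict (Set.range e \ {e i})).componentOf (v (i + 1)) := by
    intro k
    induction k with
    | zero => intro _; simpa using mem_componentOf_self _
    | succ k ih =>
      intro hk
      refine mem_componentOf_trans (ih (by omega)) (mem_componentOf_of_adj
        ⟨e (i + 1 + (k : Fin (n + 1))), ⟨⟨_, rfl⟩, fun h => ?_⟩, ?_⟩)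
      -- Meeting `e i` again would force `n + 1` to divide `k + 1`, although `k < n`.
      · have h1 := hinj h
        rw [add_assoc, add_eq_left] at h1
        have h2 : ((k + 1 : ℕ) : Fin (n + 1)) = 0 := by
          rw [Nat.cast_succ]; exact (add_comm _ _).trans h1
        rw [Fin.natCast_eq_zero] at h2
        exact absurd (Nat.le_of_dvd (by omega) h2) (by omega)
      · have := hl (i + 1 + (k : Fin (n + 1)))
        rwa [add_assoc (i + 1), ← Nat.cast_succ] at this
  have := key n le_rfl
  rwa [add_assoc, add_comm (1 : Fin (n + 1)), ← Nat.cast_succ, Fin.natCast_self, add_zero] at this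

/-- A vertex that can be reached can be reached by a path. -/
theorem exists_path_of_mem_componentOf {x y : α} (h : y ∈ G.componentOf x) :
    ∃ (n : ℕ) (v : ℕ → α), v 0 = x ∧ v n = y ∧
      (∀ i < n, G.Adj (v i) (v (i + 1))) ∧ Set.InjOn v (Set.Iic n) := by
  classical
  have hex : ∃ (n : ℕ) (v : ℕ → α), v 0 = x ∧ v n = y ∧ ∀ i < n, G.Adj (v i) (v (i + 1)) := by
    induction h with
    | refl => exact ⟨0, fun _ => x, rfl, rfl, by simp⟩
    | @tail b c _ h ih =>
      obtain ⟨n, v, h0, hn, hv⟩ := ih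
      refine ⟨n + 1, fun i => if i ≤ n then v i else c, by simpa using h0, by simp, fun i hi => ?_⟩
      rcases Nat.lt_succ_iff_lt_or_eq.1 hi with hi | rfl
      · simpa [hi.le, Nat.succ_le_of_lt hi] using hv i hi
      · simpa [hn] using h
  obtain ⟨v, h0, hn, hv⟩ := Nat.find_spec hex
  have hmin := fun m => Nat.find_min hex (m := m)
  generalize Nat.find hex = n at hn hv hmin
  -- In a walk of minimal length no vertex repeats: otherwise the stretch from `i` to `j` could be
  -- cut out.
  have hshort : ∀ i j, i < j → j ≤ n → v i ≠ v j := by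
    intro i j hij hj heq
    refine hmin (n - (j - i)) (by omega) ⟨fun k => if k ≤ i then v k else v (k + (j - i)),
      by simpa using h0, ?_, fun k hk => ?_⟩
    · rcases hj.lt_or_eq with h | rfl
      · have h1 : ¬ n - (j - i) ≤ i := by omega
        have h2 : n - (j - i) + (j - i) = n := by omega
        simp [h1, h2, hn]
      · have h1 : j - (j - i) = i := by omega
        simp [h1, heq, hn]
    · rcases lt_trichotomy k i with h | rfl | h
      · simpa [h.le, Nat.succ_le_of_lt h] using hv k (by omega)
      · have h2 : k + 1 + (j - k) = j + 1 := by omega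
        simpa [h2, heq] using hv j (by omega)
      · have h2 : k + 1 + (j - i) = k + (j - i) + 1 := by omega
        have h3 : ¬ k ≤ i := by omega
        have h4 : ¬ k + 1 ≤ i := by omega
        simpa [h2, h3, h4] using hv (k + (j - i)) (by omega)
  refine ⟨n, v, h0, hn, hv, fun i hi j hj h => ?_⟩
  by_contra hne
  rcases lt_or_gt_of_ne hne with hlt | hlt
  · exact hshort i j hlt hj h
  · exact hshort j i hlt hi h.symm

/-- A path in `A` between the ends of `e` is closed up by `e`, placed at index `n`. Distinct
vertices on the path force distinct edges. -/
theorem exists_isCycleSet_of_mem_edgeSpan {A : Set ε} {e : ε} (h : e ∈ G.edgeSpan A) (he : e ∉ A) :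
    ∃ C, G.IsCycleSet C ∧ e ∈ C ∧ C ⊆ insert e A := by
  obtain ⟨x, y, hl, hc⟩ := h
  obtain ⟨n, v, rfl, rfl, hadj, hinj⟩ := exists_path_of_mem_componentOf hc
  have hex : ∀ i, ∃ f, (i < n → f ∈ A ∧ G.IsLink f (v i) (v (i + 1))) ∧ (¬ i < n → f = e) := by
    intro i
    by_cases hi : i < n
    · obtain ⟨f, hf, hfl⟩ := restrict_adj_iff.1 (hadj i hi)
      exact ⟨f, fun _ => ⟨hf, hfl⟩, fun h => absurd hi h⟩
    · exact ⟨e, fun h => absurd h hi, fun _ => rfl⟩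
  choose f hf hfe using hex
  have hfn : f n = e := hfe n (lt_irrefl n)
  have hneq : ∀ i j, i < j → j ≤ n → f i ≠ f j := by
    intro i j hij hj heq
    have hi := hf i (by omega)
    rcases hj.lt_or_eq with hj' | rfl
    · have hjl := (hf j hj').2
      rw [← heq] at hjl
      rcases hi.2.left_eq_or_eq hjl with h | h
      · exact absurd (hinj (show i ≤ n by omega) (show j ≤ n by omega) h) (by omega)
      · exact absurd (hinj (show i ≤ n by omega) (show j + 1 ≤ n by omega) h) (by omega)
    · exact he (hfn ▸ heq ▸ hi.1)
  refine ⟨Set.range fun i : Fin (n + 1) => f i, ⟨n, fun i => v i, fun i => f i,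
    fun i j h => Fin.ext (hinj (Nat.lt_succ_iff.1 i.2) (Nat.lt_succ_iff.1 j.2) h), fun i j h => ?_,
    fun i => ?_, rfl⟩, ⟨Fin.last n, by simpa using hfn⟩, ?_⟩
  · by_contra hne
    rcases lt_or_gt_of_ne hne with hlt | hlt
    · exact hneq i j hlt (Nat.lt_succ_iff.1 j.2) h
    · exact hneq j i hlt (Nat.lt_succ_iff.1 i.2) h.symm
  · refine Fin.lastCases ?_ (fun i => ?_) i
    · simpa [hfn] using hl.symm
    · simpa using (hf i i.2).2
  · rintro _ ⟨i, rfl⟩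
    by_cases hi : (i : ℕ) < n
    · exact Or.inr (hf i hi).1
    · exact Or.inl (hfe i hi)

/-! ### Spanning forests and spanning trees -/

theorem isSpanningForest_iff {F : Set ε} :
    G.IsSpanningForest F ↔ F ⊆ E(G) ∧ ∀ C ⊆ F, ¬ G.IsCycleSet C := by
  simp only [IsSpanningForest, isCycleSet_restrict_iff]
  exact and_congr_right fun _ => ⟨fun h C hC hc => h C ⟨hc, hC⟩, fun h C hc => h C hc.2 hc.1⟩

theorem IsSpanningForest.notMem_edgeSpan {F : Set ε} (h : G.IsSpanningForest F) {e : ε}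
    (he : e ∈ F) {A : Set ε} (hA : A ⊆ F) (heA : e ∉ A) : e ∉ G.edgeSpan A := by
  intro hs
  obtain ⟨C, hC, -, hCs⟩ := exists_isCycleSet_of_mem_edgeSpan hs heA
  exact (isSpanningForest_iff.1 h).2 C (hCs.trans (Set.insert_subset he hA)) hC

theorem isSpanningForest_of_forall_isCycleSet {F : Set ε} (hF : F ⊆ E(G))
    (h : ∀ C ⊆ F, G.IsCycleSet C → ∃ e ∈ C, e ∉ G.edgeSpan (C \ {e})) : G.IsSpanningForest F := by
  refine isSpanningForest_iff.2 ⟨hF, fun C hCF hC => ?_⟩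
  obtain ⟨e, he, hne⟩ := h C hCF hC
  exact hne (hC.mem_edgeSpan he)

theorem isSpanningTree_iff {T : Set ε} :
    G.IsSpanningTree T ↔ G.IsSpanningForest T ∧ E(G) ⊆ G.edgeSpan T := by
  refine and_congr_right fun hT => ⟨fun h e he => ?_, ?_⟩
  · obtain ⟨x, y, hl⟩ := G.exists_isLink_of_mem_edgeSet he
    refine ⟨x, y, hl, ?_⟩
    have := (h _ ⟨x, hl.left_mem, rfl⟩).2 x (mem_componentOf_self x) y
      (mem_componentOf_of_adj hl.adj)
    refine componentOf_mono (fun a b hab => mem_componentOf_of_adj ?_) x this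
    obtain ⟨f, hf, -, -⟩ := hab
    exact ⟨f, hf⟩
  · rintro h _ ⟨x, hx, rfl⟩
    refine ⟨⟨x, mem_componentOf_self x⟩, fun a ha b hb => ?_⟩
    change a ∈ G.componentOf x at ha
    change b ∈ G.componentOf x at hb
    have hab : b ∈ (G.restrict T).componentOf a :=
      componentOf_mono (fun u w ⟨f, hf⟩ => hf.mem_edgeSpan_iff.1 (h hf.edge_mem)) a
        (mem_componentOf_trans (mem_componentOf_symm ha) hb)
    clear hb
    induction hab with
    | refl => exact mem_componentOf_self a
    | @tail u w hu huw ih =>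
      obtain ⟨f, hf⟩ := huw
      have hau : u ∈ G.componentOf x :=
        mem_componentOf_trans ha (componentOf_mono (fun _ _ ⟨f, hf⟩ =>
          mem_componentOf_of_adj ⟨f, hf.2⟩) a hu)
      exact mem_componentOf_trans ih (mem_componentOf_of_adj ⟨f, hf, hau,
        mem_componentOf_trans hau (mem_componentOf_of_adj ⟨f, hf.2⟩)⟩)

theorem IsSpanningTree.isSpanningForest {T : Set ε} (h : G.IsSpanningTree T) :
    G.IsSpanningForest T := h.1

theorem IsSpanningTree.subset_edgeSet {T : Set ε} (h : G.IsSpanningTree T) : T ⊆ E(G) := h.1.1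

/-- Basis exchange: if `T \ {e}` spanned `f`, the exchanged tree would span no more than `T \ {e}`,
which misses `e`. -/
theorem IsSpanningTree.mem_cut_iff {T : Set ε} (hT : G.IsSpanningTree T) {e : ε} (he : e ∈ T)
    {f : ε} : f ∈ G.cut T e ↔ f ∈ E(G) ∧ f ∉ G.edgeSpan (T \ {e}) := by
  have hspan := (isSpanningTree_iff.1 hT).2
  have hTF := isSpanningForest_iff.1 hT.isSpanningForest
  refine and_congr_right fun hf => ⟨fun h hfs => ?_, fun hfs => isSpanningTree_iff.2 ⟨?_, ?_⟩⟩
  · refine hT.isSpanningForest.notMem_edgeSpan he (A := T \ {e}) Set.sdiff_subset (by simp) ?_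
    exact edgeSpan_subset_of_subset (Set.insert_subset hfs
      (subset_edgeSpan (Set.sdiff_subset.trans hTF.1)))
      ((isSpanningTree_iff.1 h).2 (hTF.1 he))
  · refine isSpanningForest_iff.2 ⟨Set.insert_subset hf (Set.sdiff_subset.trans hTF.1),
      fun C hCs hC => ?_⟩
    by_cases hfC : f ∈ C
    · exact hfs (edgeSpan_mono (by grind) (hC.mem_edgeSpan hfC))
    · exact hTF.2 C (by grind) hC
  · refine hspan.trans (edgeSpan_subset_of_subset fun g hg => ?_)
    -- Only the removed edge needs an argument. If `f ∉ T`, the cycle closed by `f` must pass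
    -- through it, since otherwise `T \ {e}` would span `f`; the rest of that cycle then spans it.
    by_cases hge : g = e
    · subst hge
      by_cases hfT : f ∈ T
      · have hfg : f = g := by
          by_contra hne
          exact hfs (mem_edgeSpan hf ⟨hfT, hne⟩)
        exact mem_edgeSpan (hTF.1 hg) (Or.inl hfg.symm)
      · obtain ⟨C, hC, hfC, hCs⟩ := exists_isCycleSet_of_mem_edgeSpan (hspan hf) hfT
        have hgC : g ∈ C := by
          by_contra hgC
          exact hfs (edgeSpan_mono (by grind) (hC.mem_edgeSpan hfC))
        exact edgeSpan_mono (by grind) (hC.mem_edgeSpan hgC)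
    · exact mem_edgeSpan (hTF.1 hg) (Or.inr ⟨hg, hge⟩)

/-! ### Activities -/

section LinearOrder

variable [LinearOrder ε]

/-- Deleting the minimum `e` of a cycle leaves larger edges of `F` that span `e`; conversely `e`
closes a cycle with the larger edges spanning it. Activity thus becomes a closure condition. -/
theorem mem_externallyActive_iff {F : Set ε} {e : ε} :
    e ∈ G.externallyActive F ↔ e ∉ F ∧ e ∈ G.edgeSpan {f ∈ F | e < f} := by
  constructor
  · rintro ⟨⟨-, heF⟩, C, hC, heC, hle⟩
    rw [isCycleSet_restrict_iff] at hC
    refine ⟨heF, edgeSpan_mono (fun f hf => ?_) (hC.1.mem_edgeSpan heC)⟩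
    refine ⟨?_, ?_⟩
    · exact (hC.2 hf.1).resolve_left hf.2
    · exact lt_of_le_of_ne (hle hf.1) (Ne.symm hf.2)
  · rintro ⟨heF, hes⟩
    obtain ⟨C, hC, heC, hCs⟩ := exists_isCycleSet_of_mem_edgeSpan hes (fun h => heF h.1)
    refine ⟨⟨edgeSpan_subset _ hes, heF⟩, C, isCycleSet_restrict_iff.2 ⟨hC, ?_⟩, heC, ?_⟩
    · exact hCs.trans (Set.insert_subset_insert fun f hf => hf.1)
    · intro f hf
      rcases hCs hf with rfl | h
      · exact le_rfl
      · exact h.2.le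

theorem IsSpanningTree.mem_internallyInactive_iff {T : Set ε} (hT : G.IsSpanningTree T) {e : ε} :
    e ∈ G.internallyInactive T ↔ e ∈ T ∧ ∃ f ∈ E(G), f < e ∧ f ∉ G.edgeSpan (T \ {e}) := by
  refine and_congr_right fun he => ?_
  have hec : e ∈ G.cut T e := (hT.mem_cut_iff he).2 ⟨hT.subset_edgeSet he,
    hT.isSpanningForest.notMem_edgeSpan he Set.sdiff_subset (by simp)⟩
  simp only [IsLeast, hec, true_and, mem_lowerBounds, hT.mem_cut_iff he]
  rw [← not_iff_comm]
  grind

/-- An externally active edge is spanned by the larger internally inactive edges. -/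
theorem IsSpanningTree.mem_edgeSpan_of_mem_externallyActive {T : Set ε} (hT : G.IsSpanningTree T)
    {e : ε} (he : e ∈ G.externallyActive T) :
    e ∈ G.edgeSpan {f ∈ G.internallyInactive T | e < f} := by
  obtain ⟨heT, hes⟩ := mem_externallyActive_iff.1 he
  obtain ⟨C, hC, heC, hCs⟩ := exists_isCycleSet_of_mem_edgeSpan hes (fun h => heT h.1)
  refine edgeSpan_mono (fun f hf => ?_) (hC.mem_edgeSpan heC)
  have hfT := (hCs hf.1).resolve_left hf.2
  -- The smaller edge `e` witnesses that `f` is inactive: if `T \ {f}` spanned `e`, it would span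
  -- the rest of the cycle and hence `f`.
  refine ⟨hT.mem_internallyInactive_iff.2 ⟨hfT.1, e, edgeSpan_subset _ hes, hfT.2, fun h => ?_⟩,
    hfT.2⟩
  refine hT.isSpanningForest.notMem_edgeSpan hfT.1 (A := T \ {f}) Set.sdiff_subset (by simp) ?_
  refine edgeSpan_subset_of_subset ?_ (hC.mem_edgeSpan hf.1)
  rintro g ⟨hgC, hgf⟩
  rcases hCs hgC with rfl | hg
  · exact h
  · exact mem_edgeSpan (hT.subset_edgeSet hg.1) ⟨hg.1, hgf⟩

end LinearOrder

/-! ### The partitions of the set of all spanning subgraphs -/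

section LinearOrder

variable [LinearOrder ε]

/-- The spanning forest of `(V(G), A)` that is built greedily, starting with the largest edges. -/
def maxForest (G : Graph α ε) (A : Set ε) : Set ε :=
  {e ∈ A | e ∉ G.edgeSpan {f ∈ A | e < f}}

theorem maxForest_subset (A : Set ε) : G.maxForest A ⊆ A := fun _ h => h.1

/-- The largest counterexample was rejected by the greedy rule, so larger edges of `A` span it, and
these satisfy the claim. -/
theorem mem_edgeSpan_maxForest_of_mem {A : Set ε} (hfin : A.Finite) (hA : A ⊆ E(G)) {e : ε}
    (he : e ∈ A) : e ∈ G.edgeSpan {f ∈ G.maxForest A | e ≤ f} := by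
  by_contra hne
  obtain ⟨m, ⟨hmA, hm⟩, hmax⟩ := Set.exists_max_image
    {e ∈ A | e ∉ G.edgeSpan {f ∈ G.maxForest A | e ≤ f}} id (hfin.subset fun _ h => h.1)
    ⟨e, he, hne⟩
  have hmF : m ∉ G.maxForest A := fun h => hm (mem_edgeSpan (hA hmA) ⟨h, le_rfl⟩)
  have hms : m ∈ G.edgeSpan {f ∈ A | m < f} := by
    by_contra h
    exact hmF ⟨hmA, h⟩
  refine hm (edgeSpan_subset_of_subset (fun g hg => ?_) hms)
  by_contra hgs
  refine absurd (hmax g ⟨hg.1, fun h => hgs (mem_edgeSpan_of_subset (fun f hf => ?_) h)⟩) (not_le.2 hg.2)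
  exact ⟨hf.1, hg.2.le.trans hf.2⟩

theorem edgeSpan_gt_subset_edgeSpan_maxForest_gt {A : Set ε} (hfin : A.Finite) (hA : A ⊆ E(G))
    (e : ε) : G.edgeSpan {f ∈ A | e < f} ⊆ G.edgeSpan {f ∈ G.maxForest A | e < f} :=
  edgeSpan_subset_of_subset fun _ hg =>
    mem_edgeSpan_of_subset (fun _ hf => ⟨hf.1, hg.2.trans_le hf.2⟩)
      (mem_edgeSpan_maxForest_of_mem hfin hA hg.1)

/-- The smallest edge of `C` works: the others are larger edges of `A`, which do not span an edge
that the greedy rule kept. -/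
theorem exists_mem_notMem_edgeSpan_of_subset_maxForest {A C : Set ε} (hC : G.IsCycleSet C)
    (hCs : C ⊆ G.maxForest A) : ∃ e ∈ C, e ∉ G.edgeSpan (C \ {e}) := by
  obtain ⟨e, he, hmin⟩ := Set.exists_min_image C id hC.finite hC.nonempty
  refine ⟨e, he, fun h => (hCs he).2 (mem_edgeSpan_of_subset (fun f hf => ⟨(hCs hf.1).1, ?_⟩) h)⟩
  exact lt_of_le_of_ne (hmin f hf.1) (Ne.symm hf.2)

/-- Every set of edges `A` lies in the interval `[F, F ∪ EA(F)]` of exactly one spanning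
forest `F`. -/
theorem existsUnique_isSpanningForest {A : Set ε} (hfin : A.Finite) (hA : A ⊆ E(G)) :
    ∃! F, G.IsSpanningForest F ∧ F ⊆ A ∧ A ⊆ F ∪ G.externallyActive F := by
  have hforest : G.IsSpanningForest (G.maxForest A) :=
    isSpanningForest_of_forall_isCycleSet ((maxForest_subset A).trans hA) fun C hCs hC =>
      exists_mem_notMem_edgeSpan_of_subset_maxForest hC hCs
  refine ⟨G.maxForest A, ⟨hforest, maxForest_subset A, fun e he => ?_⟩, ?_⟩
  · by_cases heF : e ∈ G.maxForest A
    · exact Or.inl heF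
    · refine Or.inr (mem_externallyActive_iff.2
        ⟨heF, edgeSpan_gt_subset_edgeSpan_maxForest_gt hfin hA e ?_⟩)
      by_contra h
      exact heF ⟨he, h⟩
  · rintro F ⟨hF, hFA, hAF⟩
    -- Hence above any threshold `F` and `A` have the same span, so `F` obeys the rule defining
    -- `maxForest G A`.
    have hact : ∀ e ∈ A, e ∉ F → e ∈ G.edgeSpan {f ∈ F | e < f} := fun e he heF =>
      (mem_externallyActive_iff.1 ((hAF he).resolve_left heF)).2
    ext e
    refine ⟨fun he => ⟨hFA he, fun h => ?_⟩, fun he => ?_⟩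
    · refine hF.notMem_edgeSpan he (A := {f ∈ F | e < f}) (fun f hf => hf.1)
        (fun h => lt_irrefl e h.2) (edgeSpan_subset_of_subset ?_ h)
      rintro f ⟨hfA, hef⟩
      by_cases hfF : f ∈ F
      · exact mem_edgeSpan (hA hfA) ⟨hfF, hef⟩
      · exact mem_edgeSpan_of_subset (fun g hg => ⟨hg.1, hef.trans hg.2⟩) (hact f hfA hfF)
    · by_contra heF
      exact he.2 (mem_edgeSpan_of_subset (fun f hf => ⟨hFA hf.1, hf.2⟩) (hact e he.1 heF))

/-- The spanning tree of `G` that is obtained from `maxForest G A` by adding edges outside `A`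
greedily, starting with the smallest edges. -/
def greedyTree (G : Graph α ε) (A : Set ε) : Set ε :=
  G.maxForest A ∪ {e ∈ E(G) \ A | e ∉ G.edgeSpan (A ∪ {f ∈ E(G) | f < e})}

/-- In a cycle leaving `A`, the largest edge outside `A` could not have been added, as the remaining
edges lie in `A` or are smaller. A smallest unspanned edge would have been added, since `A` and all
smaller edges are spanned. -/
theorem isSpanningTree_greedyTree (hE : E(G).Finite) {A : Set ε} (hA : A ⊆ E(G)) :
    G.IsSpanningTree (G.greedyTree A) := by
  have hfin := hE.subset hA
  refine isSpanningTree_iff.2 ⟨isSpanningForest_of_forall_isCycleSet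
    (Set.union_subset ((maxForest_subset A).trans hA) fun e he => he.1.1) fun C hCs hC => ?_, ?_⟩
  · by_cases hCA : C ⊆ A
    · refine exists_mem_notMem_edgeSpan_of_subset_maxForest (A := A) hC fun e he => ?_
      exact (hCs he).resolve_right fun h => h.1.2 (hCA he)
    · obtain ⟨e, ⟨heC, heA⟩, hmax⟩ := Set.exists_max_image (C \ A) id (hC.finite.subset
        Set.sdiff_subset) (Set.nonempty_of_not_subset hCA)
      have het := (hCs heC).resolve_left fun h => heA h.1
      refine ⟨e, heC, fun h => het.2 (mem_edgeSpan_of_subset (fun f hf => ?_) h)⟩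
      by_cases hfA : f ∈ A
      · exact Or.inl hfA
      · exact Or.inr ⟨hC.subset_edgeSet hf.1, lt_of_le_of_ne (hmax f ⟨hf.1, hfA⟩) hf.2⟩
  · by_contra hns
    obtain ⟨e, ⟨heE, hes⟩, hmin⟩ := Set.exists_min_image (E(G) \ G.edgeSpan (G.greedyTree A)) id
      (hE.subset Set.sdiff_subset) (Set.nonempty_of_not_subset hns)
    have hAs : A ⊆ G.edgeSpan (G.greedyTree A) := fun f hf =>
      mem_edgeSpan_of_subset (fun g hg => Or.inl hg.1) (mem_edgeSpan_maxForest_of_mem hfin hA hf)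
    have heT : e ∉ G.greedyTree A := fun h => hes (mem_edgeSpan heE h)
    refine hes (edgeSpan_subset_of_subset (A := A ∪ {f ∈ E(G) | f < e}) ?_ ?_)
    · refine Set.union_subset hAs fun f hf => ?_
      by_contra hfs
      exact absurd (hmin f ⟨hf.1, hfs⟩) (not_le.2 hf.2)
    · by_contra h
      exact heT (Or.inr ⟨⟨heE, fun heA => hes (hAs heA)⟩, h⟩)

/-- **Crapo's partition**: every set of edges `A` lies in the interval `[II(T), T ∪ EA(T)]` of
exactly one spanning tree `T`. -/
theorem existsUnique_isSpanningTree (hE : E(G).Finite) {A : Set ε} (hA : A ⊆ E(G)) :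
    ∃! T, G.IsSpanningTree T ∧ G.internallyInactive T ⊆ A ∧ A ⊆ T ∪ G.externallyActive T := by
  have hfin := hE.subset hA
  have htree := isSpanningTree_greedyTree hE hA
  refine ⟨G.greedyTree A, ⟨htree, fun e he => ?_, fun e he => ?_⟩, ?_⟩
  -- For an inactive `e ∉ A`, let `m` be the smallest edge of its cut. The tree without `e` spans
  -- `A` and every edge below `m`, so `m` would have been added to the tree.
  · by_contra heA
    obtain ⟨heT, f, hfE, hfe, hfs⟩ := htree.mem_internallyInactive_iff.1 he
    obtain ⟨m, ⟨hmE, hme, hms⟩, hmin⟩ := Set.exists_min_image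
      {f ∈ E(G) | f < e ∧ f ∉ G.edgeSpan (G.greedyTree A \ {e})} id (hE.subset fun _ h => h.1)
      ⟨f, hfE, hfe, hfs⟩
    have hAs : A ⊆ G.edgeSpan (G.greedyTree A \ {e}) := fun f hf =>
      mem_edgeSpan_of_subset (fun g hg => ⟨Or.inl hg.1, fun h => heA (h ▸ hg.1.1)⟩)
        (mem_edgeSpan_maxForest_of_mem hfin hA hf)
    have hmT : m ∉ G.greedyTree A := fun h => hms (mem_edgeSpan hmE ⟨h, hme.ne⟩)
    refine hms (edgeSpan_subset_of_subset (A := A ∪ {f ∈ E(G) | f < m}) ?_ ?_)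
    · refine Set.union_subset hAs fun f hf => ?_
      by_contra hfs
      exact absurd (hmin f ⟨hf.1, hf.2.trans hme, hfs⟩) (not_le.2 hf.2)
    · by_contra h
      exact hmT (Or.inr ⟨⟨hmE, fun hmA => hms (hAs hmA)⟩, h⟩)
  · by_cases heT : e ∈ G.greedyTree A
    · exact Or.inl heT
    · refine Or.inr (mem_externallyActive_iff.2 ⟨heT, mem_edgeSpan_of_subset
        (fun f hf => ⟨Or.inl hf.1, hf.2⟩) (edgeSpan_gt_subset_edgeSpan_maxForest_gt hfin hA e ?_)⟩)
      by_contra h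
      exact heT (Or.inl ⟨he, h⟩)
  · rintro T ⟨hT, hIA, hAT⟩
    have hTF := hT.isSpanningForest
    have hact : ∀ e ∈ A, e ∉ T → e ∈ G.edgeSpan {f ∈ G.internallyInactive T | e < f} :=
      fun e he heT => hT.mem_edgeSpan_of_mem_externallyActive ((hAT he).resolve_left heT)
    have hI : ∀ e, {f ∈ G.internallyInactive T | e < f} ⊆ {f ∈ A ∩ T | e < f} :=
      fun e f hf => ⟨⟨hIA hf.1, hf.1.1⟩, hf.2⟩
    ext e
    by_cases heA : e ∈ A
    · have heg : e ∈ G.greedyTree A ↔ e ∉ G.edgeSpan {f ∈ A | e < f} :=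
        ⟨fun h => (h.resolve_right fun h' => h'.1.2 heA).2, fun h => Or.inl ⟨heA, h⟩⟩
      rw [heg]
      -- Inside `A`: the larger edges of `A` are spanned by larger edges of `T`, so they cannot span
      -- a tree edge. An edge outside `T` is active, hence spanned by larger inactive edges, all in
      -- `A`.
      refine ⟨fun he h => ?_, fun h => ?_⟩
      · refine hTF.notMem_edgeSpan he (A := {f ∈ T | e < f}) (fun f hf => hf.1)
          (fun h => lt_irrefl e h.2) (edgeSpan_subset_of_subset ?_ h)
        rintro f ⟨hfA, hef⟩
        by_cases hfT : f ∈ T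
        · exact mem_edgeSpan (hA hfA) ⟨hfT, hef⟩
        · exact mem_edgeSpan_of_subset (fun g hg => ⟨hg.1.1, hef.trans hg.2⟩) (hact f hfA hfT)
      · by_contra heT
        exact h (mem_edgeSpan_of_subset (fun f hf => ⟨(hI e hf).1.1, hf.2⟩) (hact e heA heT))
    -- Outside `A`: a tree edge `e` is not inactive, so `T \ {e}` spans all smaller edges; it also
    -- spans `A`.
    · refine ⟨fun he => Or.inr ⟨⟨hT.subset_edgeSet he, heA⟩, fun h => ?_⟩, fun h => ?_⟩
      · refine hTF.notMem_edgeSpan he (A := T \ {e}) Set.sdiff_subset (by simp)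
          (edgeSpan_subset_of_subset (Set.union_subset (fun f hf => ?_) fun f hf => ?_) h)
        · by_cases hfT : f ∈ T
          · exact mem_edgeSpan (hA hf) ⟨hfT, fun h => heA (h ▸ hf)⟩
          · exact mem_edgeSpan_of_subset (fun g hg => ⟨hg.1.1, fun h => heA (h ▸ hIA hg.1)⟩)
              (hact f hf hfT)
        · by_contra hfs
          exact heA (hIA (hT.mem_internallyInactive_iff.2 ⟨he, f, hf.1, hf.2, hfs⟩))
      -- Conversely, if `e ∉ T`, every other edge of the cycle it closes with `T` is in `A` or below
      -- `e`: one above `e` has `e` in its cut, so it is inactive and lies in `A`. Then `e` was not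
      -- eligible.
      · replace h := h.resolve_left fun h' => heA h'.1
        by_contra heT
        obtain ⟨C, hC, heC, hCs⟩ :=
          exists_isCycleSet_of_mem_edgeSpan ((isSpanningTree_iff.1 hT).2 h.1.1) heT
        refine h.2 (mem_edgeSpan_of_subset (fun f hf => ?_) (hC.mem_edgeSpan heC))
        have hfT := (hCs hf.1).resolve_left hf.2
        by_contra hfA
        have hfe : e ≤ f := by
          by_contra hlt
          exact hfA (Or.inr ⟨hT.subset_edgeSet hfT, not_le.1 hlt⟩)
        have hes : e ∉ G.edgeSpan (T \ {f}) := fun hes => by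
          refine hTF.notMem_edgeSpan hfT (A := T \ {f}) Set.sdiff_subset (by simp)
            (edgeSpan_subset_of_subset ?_ (hC.mem_edgeSpan hf.1))
          rintro g ⟨hgC, hgf⟩
          rcases hCs hgC with rfl | hg
          · exact hes
          · exact mem_edgeSpan (hT.subset_edgeSet hg) ⟨hg, hgf⟩
        exact hfA (Or.inl (hIA (hT.mem_internallyInactive_iff.2
          ⟨hfT, e, h.1.1, lt_of_le_of_ne hfe (Ne.symm hf.2), hes⟩)))

theorem externallyActive_subset_edgeSpan (F : Set ε) :
    G.externallyActive F ⊆ G.edgeSpan F := fun _ he =>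
  mem_edgeSpan_of_subset (fun _ h => h.1) (mem_externallyActive_iff.1 he).2

theorem IsSpanningTree.externallyActive_subset_edgeSpan_internallyInactive {T : Set ε}
    (hT : G.IsSpanningTree T) : G.externallyActive T ⊆ G.edgeSpan (G.internallyInactive T) :=
  fun _ he => mem_edgeSpan_of_subset (fun _ h => h.1) (hT.mem_edgeSpan_of_mem_externallyActive he)

end LinearOrder

/-! ### The Fortuin–Kasteleyn expansion -/

/-- Such `τ` are `σ ∘ c` for a unique `σ`, so distributivity applies with one free spin per class.
-/
theorem sum_factorsThrough_prod {V K S R : Type*} [Fintype V] [Fintype K] [Fintype S] [Nonempty S]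
    [DecidableEq V] [DecidableEq K] [DecidableEq S] [CommRing R] {c : V → K}
    (hc : Function.Surjective c) [DecidablePred fun τ : V → S => τ.FactorsThrough c]
    (g : V → S → R) :
    ∑ τ : V → S with τ.FactorsThrough c, ∏ v, g v (τ v) = ∏ k, ∑ s, ∏ v with c v = k, g v s := by
  have himage : ({τ : V → S | τ.FactorsThrough c} : Finset (V → S)) =
      Finset.univ.image fun σ : K → S => σ ∘ c := by
    ext τ
    simp [Function.factorsThrough_iff, eq_comm]
  rw [himage, Finset.sum_image (hc.injective_comp_right.injOn), Finset.prod_univ_sum,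
    Fintype.piFinset_univ]
  refine Finset.sum_congr rfl fun σ _ => ?_
  rw [← Finset.prod_fiberwise Finset.univ c]
  refine Finset.prod_congr rfl fun k _ => Finset.prod_congr rfl fun v hv => ?_
  rw [← (Finset.mem_filter.1 hv).2, Function.comp_apply]

theorem weight_eq_sum_filter [Fintype V(G)] (z : α → ℂ) {C : Set α} (hC : C ⊆ V(G))
    [DecidablePred fun v : V(G) => (v : α) ∈ C] :
    weight z C = ∑ v ∈ ({v : V(G) | (v : α) ∈ C} : Finset V(G)), z v := by
  have h : C = Subtype.val '' (({v : V(G) | (v : α) ∈ C} : Finset V(G)) : Set V(G)) := by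
    ext x
    simpa using fun hx => hC hx
  rw [weight]
  conv_lhs => rw [h]
  rw [finsum_mem_image Subtype.val_injective.injOn, finsum_mem_coe_finset]

theorem mul_map_ends_eq_one_iff (τ : V(G) → ℤˣ) (e : E(G)) :
    ((G.ends e).map τ).mul = 1 ↔
      ∀ x y : V(G), G.IsLink (e : ε) (x : α) (y : α) → τ x = τ y := by
  have key : ∀ x y : V(G), G.ends e = s(x, y) → (((G.ends e).map τ).mul = 1 ↔ τ x = τ y) := by
    intro x y h
    rw [h, Sym2.map_mk, Sym2.mul_mk, mul_eq_one_iff_eq_inv, Int.units_inv_eq_self]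
  refine ⟨fun h x y hl => (key x y ((G.ends_eq_iff e x y).2 hl)).1 h, fun h => ?_⟩
  obtain ⟨x, y, hl⟩ := G.exists_isLink_of_mem_edgeSet e.2
  exact (key ⟨x, hl.left_mem⟩ ⟨y, hl.right_mem⟩ ((G.ends_eq_iff e _ _).2 hl)).2
    (h ⟨x, hl.left_mem⟩ ⟨y, hl.right_mem⟩ hl)

/-- The component of a spanning subgraph that contains a given vertex. -/
def toComponent (G : Graph α ε) (A : Set ε) (v : V(G)) : (G.restrict A).components :=
  ⟨(G.restrict A).componentOf v, v, v.2, rfl⟩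

theorem toComponent_surjective (A : Set ε) : Function.Surjective (G.toComponent A) := by
  rintro ⟨_, x, hx, rfl⟩
  exact ⟨⟨x, hx⟩, rfl⟩

theorem toComponent_eq_iff {A : Set ε} {v : V(G)} {k : (G.restrict A).components} :
    G.toComponent A v = k ↔ (v : α) ∈ (k : Set α) := by
  obtain ⟨_, x, hx, rfl⟩ := k
  exact Subtype.ext_iff.trans (eq_comm.trans componentOf_eq_iff)

/-- Equality of spins propagates along walks in `B`; this turns surviving states into one spin per
component. -/
theorem forall_mul_map_ends_eq_one_iff (τ : V(G) → ℤˣ) (B : Set E(G)) :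
    (∀ e ∈ B, ((G.ends e).map τ).mul = 1) ↔
      τ.FactorsThrough (G.toComponent (Subtype.val '' B)) := by
  simp only [mul_map_ends_eq_one_iff]
  constructor
  · intro h x y hxy
    have hy : (y : α) ∈ (G.restrict (Subtype.val '' B)).componentOf x := by
      rw [← componentOf_eq_iff]
      exact congrArg Subtype.val hxy
    have key : ∀ w, w ∈ (G.restrict (Subtype.val '' B)).componentOf x →
        ∃ hw : w ∈ V(G), τ x = τ ⟨w, hw⟩ := by
      intro w hw
      induction hw with
      | refl => exact ⟨x.2, rfl⟩
      | tail _ hadj ih =>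
        obtain ⟨_, ⟨e, he, rfl⟩, hl⟩ := restrict_adj_iff.1 hadj
        obtain ⟨_, hτ⟩ := ih
        exact ⟨hl.right_mem, hτ.trans (h e he ⟨_, hl.left_mem⟩ ⟨_, hl.right_mem⟩ hl)⟩
    exact (key y hy).2
  · intro h e he x y hl
    refine h (toComponent_eq_iff.2 ?_)
    exact mem_componentOf_symm (mem_componentOf_of_adj ⟨e, ⟨e, he, rfl⟩, hl⟩)

theorem components_finite (hV : V(G).Finite) : G.components.Finite := hV.image _

theorem subset_vertexSet_of_mem_components {C : Set α} (hC : C ∈ G.components) : C ⊆ V(G) := by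
  obtain ⟨x, hx, rfl⟩ := hC
  exact componentOf_subset_vertexSet hx

-- The shift by 3 makes spins `-1` and `1` contribute `exp (2βz)` and `exp (4βz)`; on a component of
-- weight `c` they multiply to the two terms of `x_c`.
open Classical in
theorem rfimForestX_eq_sum [Fintype V(G)] (z : α → ℂ) (β : ℂ) (B : Set E(G)) :
    G.rfimForestX z β (Subtype.val '' B) =
      ∑ τ : V(G) → ℤˣ with ∀ e ∈ B, ((G.ends e).map τ).mul = 1,
        ∏ v : V(G), Complex.exp (β * z v * (((τ v : ℤˣ) : ℤ) + 3)) := by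
  have hV : V(G).Finite := Set.toFinite _
  have hfin : (G.restrict (Subtype.val '' B)).components.Finite := components_finite hV
  have := hfin.fintype
  simp only [forall_mul_map_ends_eq_one_iff]
  rw [sum_factorsThrough_prod (toComponent_surjective _)
    fun (v : V(G)) (s : ℤˣ) => Complex.exp (β * z v * ((s : ℤ) + 3)), rfimForestX,
    ← finprod_set_coe_eq_finprod_mem, finprod_eq_prod_of_fintype]
  refine Finset.prod_congr rfl fun k _ => ?_
  have hk : (k : Set α) ⊆ V(G) := 
    subset_vertexSet_of_mem_components (G := G.restrict _) k.2
  have huniv : (Finset.univ : Finset ℤˣ) = {1, -1} := rfl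
  simp only [toComponent_eq_iff]
  rw [huniv, Finset.sum_pair (by decide), rfimX, add_comm, weight_eq_sum_filter z hk,
    ← Complex.exp_sum, ← Complex.exp_sum, Finset.mul_sum, Finset.mul_sum]
  congr 2 <;> refine Finset.sum_congr rfl fun v _ => ?_ <;> push_cast <;> ring

theorem exp_mul_units (a : ℂ) (s : ℤˣ) [Decidable (s = 1)] :
    Complex.exp (a * (s : ℤ)) =
      Complex.exp (-a) * (1 + if s = 1 then Complex.exp (2 * a) - 1 else 0) := by
  rcases eq_or_ne s 1 with rfl | hs
  · rw [if_pos rfl, add_sub_cancel, ← Complex.exp_add]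
    congr 1
    push_cast
    ring
  · rw [if_neg hs, (Int.units_eq_one_or s).resolve_left hs]
    simp

-- Each edge releases a factor `exp (-βJ)` and each vertex `exp (-3βz)`, which together form the
-- prefactor with `η`.
open Classical in
theorem exp_rfimHamiltonian [Fintype V(G)] [Fintype E(G)] (z : α → ℂ) (J β : ℂ)
    (τ : V(G) → ℤˣ) :
    Complex.exp (-β * G.rfimHamiltonian z J τ) =
      Complex.exp (-β * G.rfimEta z J) *
        ((∏ e : E(G), (1 + if ((G.ends e).map τ).mul = 1 then Complex.exp (2 * β * J) - 1 else 0)) *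
          ∏ v : V(G), Complex.exp (β * z v * (((τ v : ℤˣ) : ℤ) + 3))) := by
  have h1 : ∏ e : E(G), (1 + if ((G.ends e).map τ).mul = 1 then
      Complex.exp (2 * β * J) - 1 else 0) =
      Complex.exp (∑ e : E(G), (β * J + β * J * ((((G.ends e).map τ).mul : ℤ) : ℂ))) := by
    rw [Complex.exp_sum]
    refine Finset.prod_congr rfl fun e _ => ?_
    rw [Complex.exp_add, exp_mul_units, ← mul_assoc, ← Complex.exp_add, add_neg_cancel,
      Complex.exp_zero, one_mul, mul_assoc]
  rw [h1, ← Complex.exp_sum, ← Complex.exp_add, ← Complex.exp_add, rfimHamiltonian, rfimEta,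
    finsum_eq_sum_of_fintype, finsum_eq_sum_of_fintype, weight_eq_sum_filter z subset_rfl,
    Finset.filter_true_of_mem fun v _ => v.2, Finset.sum_add_distrib, Finset.sum_const,
    ← Finset.mul_sum, Finset.card_univ, nsmul_eq_mul, ← Nat.card_eq_fintype_card,
    Nat.card_coe_set_eq]
  have h2 : ∑ v : V(G), β * z v * (((τ v : ℤˣ) : ℤ) + 3) =
      β * ∑ v : V(G), z v * ((τ v : ℤˣ) : ℤ) + 3 * β * ∑ v : V(G), z v := by
    rw [Finset.mul_sum, Finset.mul_sum, ← Finset.sum_add_distrib]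
    exact Finset.sum_congr rfl fun v _ => by ring
  rw [h2]
  congr 1
  ring

theorem finsum_mem_powerset_edgeSet [Fintype E(G)] (f : Set ε → ℂ) :
    ∑ᶠ A ∈ 𝒫 E(G), f A = ∑ B : Finset E(G), f (Subtype.val '' (B : Set E(G))) := by
  have h : 𝒫 E(G) = Set.range fun B : Finset E(G) => Subtype.val '' (B : Set E(G)) := by
    classical
    ext A
    refine ⟨fun hA => ⟨({e : E(G) | (e : ε) ∈ A} : Finset E(G)), ?_⟩, ?_⟩
    · ext e
      simpa using fun he => hA he
    · rintro ⟨B, rfl⟩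
      rintro _ ⟨e, _, rfl⟩
      exact e.2
  rw [h, finsum_mem_range, finsum_eq_sum_of_fintype]
  exact (Set.image_injective.2 Subtype.val_injective).comp Finset.coe_injective

/-- The **Fortuin–Kasteleyn expansion** of the random field Ising model. -/
theorem rfimZ_eq_finsum_powerset (hV : V(G).Finite) (hE : E(G).Finite) (z : α → ℂ) (J β : ℂ) :
    G.rfimZ z J β = Complex.exp (-β * G.rfimEta z J) *
      ∑ᶠ A ∈ 𝒫 E(G), G.rfimForestX z β A * (Complex.exp (2 * β * J) - 1) ^ A.ncard := by
  classical
  have := hV.fintype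
  have := hE.fintype
  rw [rfimZ, finsum_eq_sum_of_fintype, finsum_mem_powerset_edgeSet]
  simp only [exp_rfimHamiltonian, ← Finset.mul_sum, Finset.prod_one_add, Finset.sum_mul]
  rw [Finset.sum_comm, Finset.powerset_univ]
  congr 1
  refine Finset.sum_congr rfl fun B _ => ?_
  rw [rfimForestX_eq_sum, Finset.sum_filter, Finset.sum_mul,
    Set.ncard_image_of_injective _ Subtype.val_injective, Set.ncard_coe_finset]
  refine Finset.sum_congr rfl fun τ _ => ?_
  rw [Finset.prod_ite_zero, Finset.prod_const]
  simp only [Finset.mem_coe]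
  split_ifs <;> ring

/-! ### Contraction -/

theorem vertexSet_contract_restrict {I T : Set ε} (hI : I ⊆ T) :
    V((G.restrict T).contract I) = (G.restrict I).componentOf '' V(G) := by
  rw [contract, vertexSet_map, restrict_restrict, Set.inter_eq_right.2 hI]
  rfl

theorem edgeSet_contract_restrict {I T : Set ε} (hT : T ⊆ E(G)) :
    E((G.restrict T).contract I) = T \ I := by
  rw [contract, edgeSet_map, edgeSet_deleteEdges, edgeSet_restrict, Set.inter_eq_right.2 hT]

theorem contract_restrict_isLink_iff {I T : Set ε} (hI : I ⊆ T) {e : ε} {K L : Set α} :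
    ((G.restrict T).contract I).IsLink e K L ↔ e ∈ T \ I ∧ ∃ x y, G.IsLink e x y ∧
      (G.restrict I).componentOf x = K ∧ (G.restrict I).componentOf y = L := by
  rw [contract, map_isLink, restrict_restrict, Set.inter_eq_right.2 hI]
  simp only [Relation.Map, deleteEdges_isLink, restrict_isLink, Set.mem_sdiff]
  grind

/-- Walks correspond: a step along `I` stays at one contracted vertex, a step along `B` is an edge
of the contraction. -/
theorem componentOf_contract_restrict {I T B : Set ε} (hI : I ⊆ T) (hB : B ⊆ T \ I) (x : α) :
    (((G.restrict T).contract I).restrict B).componentOf ((G.restrict I).componentOf x) =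
      (G.restrict I).componentOf '' (G.restrict (I ∪ B)).componentOf x := by
  apply Set.Subset.antisymm
  · intro K hK
    induction hK with
    | refl => exact ⟨x, mem_componentOf_self x, rfl⟩
    | tail _ hadj ih =>
      obtain ⟨w, hw, rfl⟩ := ih
      obtain ⟨e, he, hl⟩ := restrict_adj_iff.1 hadj
      obtain ⟨-, a, b, hab, ha, rfl⟩ := (contract_restrict_isLink_iff hI).1 hl
      refine ⟨b, mem_componentOf_trans hw (mem_componentOf_trans (componentOf_restrict_mono
        Set.subset_union_left w (componentOf_eq_iff.1 ha.symm)) ?_), rfl⟩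
      exact mem_componentOf_of_adj ⟨e, Or.inr he, hab⟩
  · rintro _ ⟨w, hw, rfl⟩
    induction hw with
    | refl => exact mem_componentOf_self _
    | @tail a b _ hadj ih =>
      obtain ⟨e, he, hl⟩ := restrict_adj_iff.1 hadj
      rcases he with he | he
      · rwa [← componentOf_eq_iff.2 (mem_componentOf_of_adj (restrict_adj_iff.2 ⟨e, he, hl⟩))]
      · exact mem_componentOf_trans ih (mem_componentOf_of_adj
          ⟨e, he, (contract_restrict_isLink_iff hI).2 ⟨hB he, a, b, hl, rfl, rfl⟩⟩)

theorem components_contract_restrict {I T B : Set ε} (hI : I ⊆ T) (hB : B ⊆ T \ I) :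
    (((G.restrict T).contract I).restrict B).components =
      Set.image (G.restrict I).componentOf '' (G.restrict (I ∪ B)).components := by
  rw [components, components, vertexSet_restrict, vertexSet_restrict,
    vertexSet_contract_restrict hI, Set.image_image, Set.image_image]
  exact Set.image_congr fun x _ => componentOf_contract_restrict hI hB x

theorem sUnion_image_componentOf {I A : Set ε} (hIA : I ⊆ A) {C : Set α}
    (hC : C ∈ (G.restrict A).components) : ⋃₀ ((G.restrict I).componentOf '' C) = C := by
  obtain ⟨x, -, rfl⟩ := hC
  ext w
  simp only [Set.sUnion_image, Set.mem_iUnion, exists_prop]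
  exact ⟨fun ⟨v, hv, hw⟩ => mem_componentOf_trans hv (componentOf_restrict_mono hIA v hw),
    fun hw => ⟨w, hw, mem_componentOf_self w⟩⟩

theorem pairwiseDisjoint_range_componentOf :
    (Set.range G.componentOf).PairwiseDisjoint id := by
  rintro _ ⟨x, rfl⟩ _ ⟨y, rfl⟩ hne
  refine Set.disjoint_left.2 fun w hx hy => hne ?_
  exact componentOf_eq_iff.2 (mem_componentOf_trans hx (mem_componentOf_symm hy))

theorem weight_weight_image_componentOf (hV : V(G).Finite) (z : α → ℂ) {I A : Set ε} (hIA : I ⊆ A)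
    {C : Set α} (hC : C ∈ (G.restrict A).components) :
    weight (weight z) ((G.restrict I).componentOf '' C) = weight z C := by
  have hCV : C ⊆ V(G) := subset_vertexSet_of_mem_components (G := G.restrict A) hC
  conv_rhs => rw [← sUnion_image_componentOf hIA hC]
  simp only [weight]
  rw [finsum_mem_sUnion]
  · exact pairwiseDisjoint_range_componentOf.subset (Set.image_subset_range _ _)
  · exact (hV.subset hCV).image _
  · rintro _ ⟨x, hx, rfl⟩
    exact hV.subset (componentOf_subset_vertexSet (G := G.restrict I) (hCV hx))

/-- Contraction matches components bijectively and keeps their total weights; a component is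
recovered as the union of the contracted vertices in it. -/
theorem rfimForestX_contract_restrict (hV : V(G).Finite) (z : α → ℂ) (β : ℂ) {I T B : Set ε}
    (hI : I ⊆ T) (hB : B ⊆ T \ I) :
    ((G.restrict T).contract I).rfimForestX (weight z) β B = G.rfimForestX z β (I ∪ B) := by
  rw [rfimForestX, rfimForestX, components_contract_restrict hI hB, finprod_mem_image]
  · exact finprod_mem_congr rfl fun C hC => by
      rw [weight_weight_image_componentOf hV z Set.subset_union_left hC]
  · intro C hC D hD h
    rw [← sUnion_image_componentOf Set.subset_union_left hC, h,
      sUnion_image_componentOf Set.subset_union_left hD]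

/-! ### Sums over intervals -/

theorem rfimForestX_eq_of_subset_edgeSpan (z : α → ℂ) (β : ℂ) {A B : Set ε} (hAB : A ⊆ B)
    (h : B ⊆ G.edgeSpan A) : G.rfimForestX z β B = G.rfimForestX z β A := by
  rw [rfimForestX, rfimForestX, components_restrict_eq_of_subset_edgeSpan hAB h]

theorem finsum_mem_powerset_pow_ncard (y : ℂ) {S : Set ε} (hS : S.Finite) :
    ∑ᶠ A ∈ 𝒫 S, y ^ A.ncard = (y + 1) ^ S.ncard := by
  lift S to Finset ε using hS
  have h : 𝒫 (S : Set ε) = (fun A : Finset ε => (A : Set ε)) '' (S.powerset : Set (Finset ε)) := by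
    rw [Finset.coe_powerset, Set.image_preimage_eq_inter_range]
    exact (Set.inter_eq_left.2 fun A hA => (S.finite_toSet.subset hA).exists_finset_coe).symm
  rw [h, finsum_mem_image Finset.coe_injective.injOn, finsum_mem_coe_finset]
  simp only [Set.ncard_coe_finset]
  rw [← Finset.sum_pow_mul_eq_add_pow]
  simp

theorem finsum_mem_image_union (f : Set ε → ℂ) {F U : Set ε} (h : Disjoint F U) :
    ∑ᶠ A ∈ (fun D => F ∪ D) '' 𝒫 U, f A = ∑ᶠ D ∈ 𝒫 U, f (F ∪ D) := by
  refine finsum_mem_image fun D hD D' hD' heq => ?_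
  rw [Set.mem_powerset_iff] at hD hD'
  have h1 := Set.disjoint_left.1 h
  have h2 := Set.ext_iff.1 heq
  ext e
  have := h2 e
  simp only [Set.mem_union] at this
  grind

theorem Icc_eq_image_union {F U : Set ε} : Set.Icc F (F ∪ U) = (fun D => F ∪ D) '' 𝒫 U := by
  ext A
  constructor
  · rintro ⟨h1, h2⟩
    exact ⟨A ∩ U, Set.inter_subset_right, by
      ext e
      have := @h1 e
      have := @h2 e
      simp only [Set.mem_union, Set.mem_inter_iff] at *
      tauto⟩
  · rintro ⟨D, hD, rfl⟩
    exact ⟨Set.subset_union_left, Set.union_subset_union_right F hD⟩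

theorem finsum_mem_Icc_rfimForestX (z : α → ℂ) (β y : ℂ) {F S : Set ε} (hF : F ⊆ E(G))
    (hFfin : F.Finite) (hS : S.Finite) (hdisj : Disjoint F S) (hspan : S ⊆ G.edgeSpan F) :
    ∑ᶠ A ∈ Set.Icc F (F ∪ S), G.rfimForestX z β A * y ^ A.ncard =
      G.rfimForestX z β F * y ^ F.ncard * (y + 1) ^ S.ncard := by
  rw [Icc_eq_image_union, finsum_mem_image_union _ hdisj, ← finsum_mem_powerset_pow_ncard y hS,
    mul_finsum_mem]
  refine finsum_mem_congr rfl fun D hD => ?_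
  rw [Set.mem_powerset_iff] at hD
  rw [rfimForestX_eq_of_subset_edgeSpan z β Set.subset_union_left
    (Set.union_subset (subset_edgeSpan hF) (hD.trans hspan)),
    Set.ncard_union_eq (hdisj.mono_right hD) hFfin (hS.subset hD), pow_add, mul_assoc]

/-- A sum over all sets of edges is the sum of the sums over the blocks of a partition. -/
theorem finsum_mem_powerset_eq_of_existsUnique (hE : E(G).Finite) (f : Set ε → ℂ)
    {𝒮 : Set (Set ε)} {a b : Set ε → Set ε} (h𝒮 : ∀ S ∈ 𝒮, S ⊆ E(G) ∧ b S ⊆ E(G))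
    (h : ∀ A ⊆ E(G), ∃! S, S ∈ 𝒮 ∧ a S ⊆ A ∧ A ⊆ b S) :
    ∑ᶠ A ∈ 𝒫 E(G), f A = ∑ᶠ S ∈ 𝒮, ∑ᶠ A ∈ Set.Icc (a S) (b S), f A := by
  have hU : 𝒫 E(G) = ⋃ S ∈ 𝒮, Set.Icc (a S) (b S) := by
    ext A
    simp only [Set.mem_powerset_iff, Set.mem_iUnion, exists_prop]
    refine ⟨fun hA => (h A hA).exists, ?_⟩
    rintro ⟨S, hS, -, hAS⟩
    exact hAS.trans (h𝒮 S hS).2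
  rw [hU, finsum_mem_biUnion]
  · intro S hS S' hS' hne
    refine Set.disjoint_left.2 fun A hA hA' => hne ?_
    exact (h A (hA.2.trans (h𝒮 S hS).2)).unique ⟨hS, hA⟩ ⟨hS', hA'⟩
  · exact hE.finite_subsets.subset fun S hS => (h𝒮 S hS).1
  · exact fun S hS => hE.finite_subsets.subset fun A hA => hA.2.trans (h𝒮 S hS).2

section LinearOrder

variable [LinearOrder ε]

theorem externallyActive_subset (F : Set ε) : G.externallyActive F ⊆ E(G) := fun _ h => h.1.1

theorem disjoint_externallyActive (F : Set ε) : Disjoint F (G.externallyActive F) :=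
  Set.disjoint_left.2 fun _ h h' => h'.1.2 h

theorem internallyInactive_subset (T : Set ε) : G.internallyInactive T ⊆ T := fun _ h => h.1

/-- The sum over the interval of a spanning tree. -/
theorem IsSpanningTree.finsum_mem_Icc_rfimForestX (hV : V(G).Finite) (hE : E(G).Finite)
    (z : α → ℂ) (β y : ℂ) {T : Set ε} (hT : G.IsSpanningTree T) :
    ∑ᶠ A ∈ Set.Icc (G.internallyInactive T) (T ∪ G.externallyActive T),
        G.rfimForestX z β A * y ^ A.ncard =
      y ^ (G.internallyInactive T).ncard * (y + 1) ^ (G.externallyActive T).ncard *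
        ∑ᶠ B ∈ 𝒫 E((G.restrict T).contract (G.internallyInactive T)),
          ((G.restrict T).contract (G.internallyInactive T)).rfimForestX (weight z) β B *
            y ^ B.ncard := by
  have hTE := hT.subset_edgeSet
  have hIT := G.internallyInactive_subset T
  have hTfin := hE.subset hTE
  rw [edgeSet_contract_restrict hTE]
  generalize hI : G.internallyInactive T = I at *
  have hspan : G.externallyActive T ⊆ G.edgeSpan I :=
    hI ▸ hT.externallyActive_subset_edgeSpan_internallyInactive
  have hSfin := hE.subset (G.externallyActive_subset T)
  have hdisj := G.disjoint_externallyActive T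
  -- The interval is sliced by `B = (A ∩ T) \ I`; within a slice only externally active edges vary,
  -- and `I` already spans them.
  have hU : Set.Icc I (T ∪ G.externallyActive T) =
      ⋃ B ∈ 𝒫 (T \ I), Set.Icc (I ∪ B) (I ∪ B ∪ G.externallyActive T) := by
    ext A
    simp only [Set.mem_iUnion, exists_prop, Set.mem_powerset_iff, Set.mem_Icc]
    constructor
    · rintro ⟨h1, h2⟩
      refine ⟨(A ∩ T) \ I, by grind, by grind, fun e he => ?_⟩
      have := h2 he
      grind
    · rintro ⟨B, hB, h1, h2⟩
      exact ⟨Set.subset_union_left.trans h1, h2.trans (Set.union_subset_union_left _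
        (Set.union_subset hIT (hB.trans Set.sdiff_subset)))⟩
  rw [hU, finsum_mem_biUnion, mul_finsum_mem]
  · refine finsum_mem_congr rfl fun B hB => ?_
    rw [Set.mem_powerset_iff] at hB
    have hIBT : I ∪ B ⊆ T := Set.union_subset hIT (hB.trans Set.sdiff_subset)
    rw [Graph.finsum_mem_Icc_rfimForestX z β y (hIBT.trans hTE) (hTfin.subset hIBT) hSfin
      (hdisj.mono_left hIBT) (hspan.trans (edgeSpan_mono Set.subset_union_left)),
      rfimForestX_contract_restrict hV z β hIT hB, Set.ncard_union_eq
      (Set.disjoint_left.2 fun e he he' => (hB he').2 he) (hTfin.subset hIT)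
      (hTfin.subset (hB.trans Set.sdiff_subset))]
    ring
  · intro B hB B' hB' hne
    rw [Set.mem_powerset_iff] at hB hB'
    refine Set.disjoint_left.2 fun A hA hA' => hne ?_
    have key : ∀ D ⊆ T \ I, A ∈ Set.Icc (I ∪ D) (I ∪ D ∪ G.externallyActive T) →
        D = (A ∩ T) \ I := by
      rintro D hD ⟨h1, h2⟩
      have h3 := Set.disjoint_left.1 hdisj
      ext e
      have := @hD e
      have := @h1 e
      have := @h2 e
      have := @h3 e
      simp only [Set.mem_union, Set.mem_sdiff, Set.mem_inter_iff] at *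
      tauto
    rw [key B hB hA, key B' hB' hA']
  · exact (hTfin.subset Set.sdiff_subset).finite_subsets
  · intro B hB
    exact hE.finite_subsets.subset fun A hA => hA.2.trans (Set.union_subset (Set.union_subset
      (hIT.trans hTE) ((Set.mem_powerset_iff _ _).1 hB |>.trans Set.sdiff_subset |>.trans hTE))
      (G.externallyActive_subset T))

/-! ### The forest and tree expansions -/

theorem finprod_mem_const {ι : Type*} {s : Set ι} (hs : s.Finite) (c : ℂ) :
    ∏ᶠ _i ∈ s, c = c ^ s.ncard := by
  lift s to Finset ι using hs
  rw [finprod_mem_coe_finset, Finset.prod_const, Set.ncard_coe_finset]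

/-- The expansion over spanning forests. -/
theorem rfimZ_eq_finsum_isSpanningForest (hV : V(G).Finite) (hE : E(G).Finite) (z : α → ℂ)
    (J β : ℂ) :
    G.rfimZ z J β = Complex.exp (-β * G.rfimEta z J) *
      ∑ᶠ F ∈ {F : Set ε | G.IsSpanningForest F},
        G.rfimForestX z β F * (Complex.exp (2 * β * J) - 1) ^ F.ncard *
          ∏ᶠ _e ∈ G.externallyActive F, Complex.exp (2 * β * J) := by
  rw [rfimZ_eq_finsum_powerset hV hE, finsum_mem_powerset_eq_of_existsUnique hE
    (𝒮 := {F : Set ε | G.IsSpanningForest F}) (a := id) (b := fun F => F ∪ G.externallyActive F) _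
    (fun F hF => ⟨hF.1, Set.union_subset hF.1 (G.externallyActive_subset F)⟩)
    fun A hA => existsUnique_isSpanningForest (hE.subset hA) hA]
  congr 1
  refine finsum_mem_congr rfl fun F hF => ?_
  have hS := hE.subset (G.externallyActive_subset F)
  rw [id, finsum_mem_Icc_rfimForestX z β _ hF.1 (hE.subset hF.1) hS
    (G.disjoint_externallyActive F) (externallyActive_subset_edgeSpan F), finprod_mem_const hS,
    sub_add_cancel]

/-- The expansion over spanning trees. -/
theorem rfimZ_eq_finsum_isSpanningTree (hV : V(G).Finite) (hE : E(G).Finite) (z : α → ℂ)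
    (J β : ℂ) :
    G.rfimZ z J β = Complex.exp (-β * G.rfimEta z J) *
      ∑ᶠ T ∈ {T : Set ε | G.IsSpanningTree T},
        (Complex.exp (2 * β * J) - 1) ^ (G.internallyInactive T).ncard *
          Complex.exp (2 * β * J * ((G.externallyActive T).ncard : ℂ) +
            β * ((G.restrict T).contract (G.internallyInactive T)).rfimEta (weight z) J) *
          ((G.restrict T).contract (G.internallyInactive T)).rfimZ (weight z) J β := by
  rw [rfimZ_eq_finsum_powerset hV hE, finsum_mem_powerset_eq_of_existsUnique hE
    (𝒮 := {T : Set ε | G.IsSpanningTree T}) (a := G.internallyInactive)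
    (b := fun T => T ∪ G.externallyActive T) _
    (fun T hT => ⟨hT.subset_edgeSet,
      Set.union_subset hT.subset_edgeSet (G.externallyActive_subset T)⟩)
    fun A hA => existsUnique_isSpanningTree hE hA]
  congr 1
  refine finsum_mem_congr rfl fun T hT => ?_
  have hVH : V((G.restrict T).contract (G.internallyInactive T)).Finite := by
    rw [vertexSet_contract_restrict (G.internallyInactive_subset T)]
    exact hV.image _
  have hEH : E((G.restrict T).contract (G.internallyInactive T)).Finite := by
    rw [edgeSet_contract_restrict hT.subset_edgeSet]
    exact hE.subset (Set.sdiff_subset.trans hT.subset_edgeSet)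
  -- The expansion of the contraction carries its own `exp (-βη)`, which the factor `exp (βη)` in
  -- the statement cancels.
  rw [IsSpanningTree.finsum_mem_Icc_rfimForestX hV hE z β _ hT,
    rfimZ_eq_finsum_powerset hVH hEH, sub_add_cancel, ← Complex.exp_nat_mul, Complex.exp_add,
    mul_comm (2 * β * J) (Set.ncard _ : ℂ), neg_mul, Complex.exp_neg]
  field_simp

end LinearOrder

end Graph

theorem mainTheorem9 {α ε : Type*} [LinearOrder ε] (G : Graph α ε)
    (hV : G.vertexSet.Finite) (hE : G.edgeSet.Finite) (z : α → ℂ) (J β : ℂ) :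
    (G.rfimZ z J β =
      Complex.exp (-β * G.rfimEta z J) *
        ∑ᶠ F ∈ {F : Set ε | G.IsSpanningForest F},
          G.rfimForestX z β F * (Complex.exp (2 * β * J) - 1) ^ F.ncard *
            ∏ᶠ _e ∈ G.externallyActive F, Complex.exp (2 * β * J)) ∧
    (G.rfimZ z J β =
      Complex.exp (-β * G.rfimEta z J) *
        ∑ᶠ T ∈ {T : Set ε | G.IsSpanningTree T},
          (Complex.exp (2 * β * J) - 1) ^ (G.internallyInactive T).ncard *
            Complex.exp (2 * β * J * ((G.externallyActive T).ncard : ℂ) +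
              β * ((G.restrict T).contract (G.internallyInactive T)).rfimEta (Graph.weight z) J) *
            ((G.restrict T).contract (G.internallyInactive T)).rfimZ (Graph.weight z) J β) :=
  ⟨Graph.rfimZ_eq_finsum_isSpanningForest hV hE z J β,
    Graph.rfimZ_eq_finsum_isSpanningTree hV hE z J β⟩
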